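/- Let $k$ be a field with algebraic closure $\bar k$, and let $C$ be a curve over $k$, where a curve over $k$ means a smooth, proper, geometrically irreducible $k$-scheme of dimension $1$. Let $(D,\pi_1,\pi_2)$ be a self-correspondence on $C$, that is: $D$ is a smooth and proper $k$-scheme each of whose connected components is a curve over $k$, and $\pi_1,\pi_2\colon D\to C$ are $k$-morphisms whose restrictions to every connected component of $D$ are non-constant and separable (the induced extension of function fields is separable). Let $\Gamma_D$ be the directed graph (loops and repeated edges allowed) with vertex set $C(\bar k)$, edge set $D(\bar k)$, source map $\pi_1$ and target map $\pi_2$. A set $S\subseteq C(\bar k)$ is complete if, for every edge $z\in D(\bar k)$, $\pi_1(z)\in S$ if and only if $\pi_2(z)\in S$; a complete set is irreducible if it is non-empty and contains no complete proper non-empty subset. An edge $z\in D(\bar k)$ is étale if the ramification indices at $z$ of $\pi_1$ and $\pi_2$ (base changed to $\bar k$) are both equal to $1$, and a set $S\subseteq C(\bar k)$ is étale if every edge $z$ with $\pi_1(z)\in S$ and $\pi_2(z)\in S$ is étale. Then $\Gamma_D$ has infinitely many irreducible complete sets, and all but finitely many irreducible complete sets of $\Gamma_D$ are étale. -/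

import Mathlib

open CategoryTheory CategoryTheory.Limits AlgebraicGeometry

universe u

/-- A directed graph: a set `V` of vertices, a set `Z` of edges, and source and target maps.
Self-loops and repeated edges are allowed. -/
structure DirectedGraph where
  /-- the vertices -/
  V : Type u
  /-- the edges -/
  Z : Type u
  /-- the source of an edge -/
  s : Z → V
  /-- the target of an edge -/
  t : Z → V

namespace DirectedGraph

variable (Γ : DirectedGraph.{u})

/-- `y` is a forward-neighbor of `x` if there is an edge with source `x` and target `y`. -/
def IsForwardNeighbor (x y : Γ.V) : Prop := ∃ z : Γ.Z, Γ.s z = x ∧ Γ.t z = y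

/-- `y` is a backward-neighbor of `x` if there is an edge with source `y` and target `x`. -/
def IsBackwardNeighbor (x y : Γ.V) : Prop := ∃ z : Γ.Z, Γ.s z = y ∧ Γ.t z = x

/-- `S` contains every forward-neighbor of its vertices. -/
def IsForwardComplete (S : Set Γ.V) : Prop := ∀ x ∈ S, ∀ y, Γ.IsForwardNeighbor x y → y ∈ S

/-- `S` contains every backward-neighbor of its vertices. -/
def IsBackwardComplete (S : Set Γ.V) : Prop := ∀ x ∈ S, ∀ y, Γ.IsBackwardNeighbor x y → y ∈ S

/-- `S` is both forward-complete and backward-complete. -/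
def IsComplete (S : Set Γ.V) : Prop := Γ.IsForwardComplete S ∧ Γ.IsBackwardComplete S

/-- A complete set is irreducible if it is non-empty and has no complete proper non-empty
subset. -/
def IsIrreducibleComplete (S : Set Γ.V) : Prop :=
  Γ.IsComplete S ∧ S.Nonempty ∧ ∀ T : Set Γ.V, T ⊂ S → T.Nonempty → ¬ Γ.IsComplete T

end DirectedGraph

/-- A curve over the field `k`: a proper smooth scheme over `Spec k`, of dimension one, and
geometrically irreducible (in particular non-empty). -/
structure IsCurve {k : Type u} [Field k] {C : Scheme.{u}} (p : C ⟶ Spec (.of k)) : Prop where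
  proper : IsProper p
  smooth : SmoothOfRelativeDimension 1 p
  irreducible : GeometricallyIrreducible p

/-- A morphism of schemes is non-constant if its image is not contained in a single point. -/
def IsNonconstant {X Y : Scheme.{u}} (f : X ⟶ Y) : Prop := ¬ ∃ y : Y, ∀ x : X, f x = y

/-- A morphism `f : X ⟶ Y` out of an irreducible scheme is separable if the homomorphism of
stalks that it induces at the generic point `η` of `X` is a separable extension. For a non-constant morphism
of curves `f η` is the generic point of `Y`, and this is the extension of function fields. -/
def IsSeparableMorphism {X Y : Scheme.{u}} (f : X ⟶ Y) : Prop :=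
  ∀ η : X, IsGenericPoint η Set.univ →
    letI := (f.stalkMap η).hom.toAlgebra
    Algebra.IsSeparable (Y.presheaf.stalk (f η)) (X.presheaf.stalk η)

/-- A self-correspondence on `C` over `k`: a smooth and proper scheme `D` over `k` each of whose
connected components is a curve, with two `k`-morphisms from `D` to `C` that are non-constant and
separable on every connected component of `D`. -/
structure SelfCorrespondence {k : Type u} [Field k] {C : Scheme.{u}}
    (p : C ⟶ Spec (.of k)) where
  /-- the scheme `D` -/
  D : Scheme.{u}
  /-- the structure morphism of `D` -/
  str : D ⟶ Spec (.of k)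
  /-- the first projection -/
  π₁ : D ⟶ C
  /-- the second projection -/
  π₂ : D ⟶ C
  comp_π₁ : π₁ ≫ p = str
  comp_π₂ : π₂ ≫ p = str
  proper : IsProper str
  smooth : Smooth str
  component : ∀ x : D, ∃ U : D.Opens, (U : Set D) = connectedComponent x ∧
    IsCurve (U.ι ≫ str) ∧
    IsNonconstant (U.ι ≫ π₁) ∧ IsSeparableMorphism (U.ι ≫ π₁) ∧
    IsNonconstant (U.ι ≫ π₂) ∧ IsSeparableMorphism (U.ι ≫ π₂)

noncomputable section

section GeometricPoints

variable {k : Type u} [Field k] (K : Type u) [Field K] [Algebra k K]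

/-- The morphism `Spec K ⟶ Spec k` attached to a field extension `K` of `k`. -/
abbrev baseMap : Spec (.of K) ⟶ Spec (.of k) :=
  Spec.map (CommRingCat.ofHom (algebraMap k K))

/-- The set `X(K)` of `K`-points of the `k`-scheme `X`. -/
abbrev KPoint {X : Scheme.{u}} (p : X ⟶ Spec (.of k)) : Type u :=
  {x : Spec (.of K) ⟶ X // x ≫ p = baseMap K}

/-- The map `X(K) → Y(K)` induced by a `k`-morphism `f : X ⟶ Y`. -/
def KPoint.map {X Y : Scheme.{u}} {p : X ⟶ Spec (.of k)} {q : Y ⟶ Spec (.of k)}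
    (f : X ⟶ Y) (hf : f ≫ q = p) (x : KPoint K p) : KPoint K q :=
  ⟨x.1 ≫ f, by rw [Category.assoc, hf, x.2]⟩

/-- The base change `X_K` of the `k`-scheme `X`. -/
abbrev baseChange {X : Scheme.{u}} (p : X ⟶ Spec (.of k)) : Scheme.{u} :=
  pullback p (baseMap (k := k) K)

/-- The base change `f_K : X_K ⟶ Y_K` of a `k`-morphism `f : X ⟶ Y`. -/
def baseChangeMap {X Y : Scheme.{u}} {p : X ⟶ Spec (.of k)} {q : Y ⟶ Spec (.of k)}
    (f : X ⟶ Y) (hf : f ≫ q = p) : baseChange K p ⟶ baseChange K q :=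
  pullback.map p (baseMap K) q (baseMap K) f (𝟙 _) (𝟙 _) (by simp [hf]) (by simp)

/-- The closed point of `X_K` defined by a `K`-point of `X`. -/
def KPoint.toBaseChange {X : Scheme.{u}} {p : X ⟶ Spec (.of k)} (x : KPoint K p) :
    baseChange K p :=
  pullback.lift x.1 (𝟙 (Spec (.of K))) (by simp [x.2]) (IsLocalRing.closedPoint K)

/-- The ramification index of a morphism of schemes `f : X ⟶ Y` at a point `z` of `X`: that of
the homomorphism of local rings from the stalk of `Y` at `f z` to the stalk of `X` at `z`. -/
def ramificationIndexAt {X Y : Scheme.{u}} (f : X ⟶ Y) (z : X) : ℕ :=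
  letI := (f.stalkMap z).hom.toAlgebra
  (IsLocalRing.maximalIdeal (X.presheaf.stalk z)).ramificationIdx (Y.presheaf.stalk (f z))

end GeometricPoints

namespace SelfCorrespondence

variable {k : Type u} [Field k] {C : Scheme.{u}} {p : C ⟶ Spec (.of k)}
  (𝒟 : SelfCorrespondence p) (kbar : Type u) [Field kbar] [Algebra k kbar]

/-- The directed graph attached to a self-correspondence: vertices `C(kbar)`, edges `D(kbar)`,
source map `π₁` and target map `π₂`. -/
def graph : DirectedGraph.{u} where
  V := KPoint kbar p
  Z := KPoint kbar 𝒟.str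
  s := KPoint.map kbar 𝒟.π₁ 𝒟.comp_π₁
  t := KPoint.map kbar 𝒟.π₂ 𝒟.comp_π₂

/-- The ramification index `e_{1,z}` of `π₁` (over `kbar`) at the edge `z`. -/
def e₁ (z : (𝒟.graph kbar).Z) : ℕ :=
  ramificationIndexAt (baseChangeMap kbar 𝒟.π₁ 𝒟.comp_π₁) (KPoint.toBaseChange kbar z)

/-- The ramification index `e_{2,z}` of `π₂` (over `kbar`) at the edge `z`. -/
def e₂ (z : (𝒟.graph kbar).Z) : ℕ :=
  ramificationIndexAt (baseChangeMap kbar 𝒟.π₂ 𝒟.comp_π₂) (KPoint.toBaseChange kbar z)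

/-- An edge is étale if both ramification indices are one. -/
def IsEtaleEdge (z : (𝒟.graph kbar).Z) : Prop := 𝒟.e₁ kbar z = 1 ∧ 𝒟.e₂ kbar z = 1

/-- A set of vertices is étale if all the edges with both source and target in it are étale. -/
def IsEtaleSet (S : Set (𝒟.graph kbar).V) : Prop :=
  ∀ z : (𝒟.graph kbar).Z, (𝒟.graph kbar).s z ∈ S → (𝒟.graph kbar).t z ∈ S →
    𝒟.IsEtaleEdge kbar z

end SelfCorrespondence

end

/-! The irreducible complete sets partition the vertices. Suppose that there are finitely many of
them, and fix an étale coordinate on an open part of C. Outside finitely many edges, the coordinates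
a and b of the endpoints satisfy F(a, b) = 0 with F(a, Y) non-zero, for F in a finite set of
polynomials (`SelfCorrespondence.exists_finite_setOf_not_polyRelated`); let d bound their degrees in
Y. Let k₀ be a subfield, finitely generated over the prime field, containing the coefficients of
these polynomials, the coordinates of one vertex from each irreducible set, and finitely many
exceptional values.

Crossing an edge costs an extension of degree at most d. Hence the vertices whose coordinates lie in
`smoothDegreeElements k₀ d` form a complete set. It meets every irreducible complete set, so it
contains all vertices. But an algebraically closed field has elements whose degree over k₀ is
divisible by a prime larger than d (`HasLargePrimeDegrees.exists_subfield`), a contradiction.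

For étaleness, separability makes both projections unramified at the generic point of each
component, hence on a dense open set, so only finitely many edges are not étale. The source of each
such edge lies in just one irreducible complete set. -/

namespace IntermediateField

/-! ### Elements of degree divisible by a large prime -/

open Polynomial

theorem finrank_adjoin_simple {F L K : Type*} [Field F] [Field L] [Field K] [Algebra F L]
    [Algebra F K] [Algebra L K] [IsScalarTower F L K] {c : K} (hc : IsIntegral L c) :
    Module.finrank F (L⟮c⟯.restrictScalars F) =
      Module.finrank F L * (minpoly L c).natDegree := by
  rw [← adjoin.finrank hc]
  exact (Module.finrank_mul_finrank F L L⟮c⟯).symm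

theorem finiteDimensional_adjoin_simple {F L K : Type*} [Field F] [Field L] [Field K]
    [Algebra F L] [Algebra F K] [Algebra L K] [IsScalarTower F L K] [FiniteDimensional F L] {c : K}
    (hc : IsIntegral L c) : FiniteDimensional F (L⟮c⟯.restrictScalars F) :=
  have := adjoin.finiteDimensional hc
  FiniteDimensional.trans F L L⟮c⟯

end IntermediateField

/-- `K` contains elements, algebraic over `F`, whose degree over `F` is divisible by any given
large enough prime number. -/
def HasLargePrimeDegrees (F K : Type*) [Field F] [Field K] [Algebra F K] : Prop :=
  ∃ N : ℕ, ∀ ℓ : ℕ, ℓ.Prime → N < ℓ → ∃ c : K, IsIntegral F c ∧ ℓ ∣ (minpoly F c).natDegree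

namespace HasLargePrimeDegrees

open Polynomial IntermediateField

/-- By the tower law a prime dividing [F(c) : F] divides [L : F] · [L(c) : L]; once it exceeds [L :
F] it must divide the second factor. -/
theorem of_finiteDimensional {F L K : Type*} [Field F] [Field L] [Field K] [Algebra F L]
    [Algebra F K] [Algebra L K] [IsScalarTower F L K] [FiniteDimensional F L]
    (h : HasLargePrimeDegrees F K) : HasLargePrimeDegrees L K := by
  obtain ⟨N, hN⟩ := h
  refine ⟨max N (Module.finrank F L), fun ℓ hℓ hlt => ?_⟩
  obtain ⟨c, hc, hdvd⟩ := hN ℓ hℓ (lt_of_le_of_lt (le_max_left _ _) hlt)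
  have hcL : IsIntegral L c := hc.tower_top
  refine ⟨c, hcL, ?_⟩
  have hle : F⟮c⟯ ≤ L⟮c⟯.restrictScalars F :=
    IntermediateField.adjoin_simple_le_iff.2 (mem_adjoin_simple_self L c)
  have h1 := finrank_dvd_of_le_right hle
  rw [adjoin.finrank hc, finrank_adjoin_simple hcL] at h1
  refine ((Nat.Prime.dvd_mul hℓ).1 (hdvd.trans h1)).resolve_left fun h4 => ?_
  have := Nat.le_of_dvd Module.finrank_pos h4
  exact absurd (lt_of_le_of_lt (le_max_right _ _) hlt) (not_lt.2 this)

theorem exists_of_forall_pow_ne {F K : Type*} [Field F] [Field K] [Algebra F K] [IsAlgClosed K]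
    {ℓ : ℕ} (hℓ : ℓ.Prime) {a : F} (ha : ∀ b : F, b ^ ℓ ≠ a) :
    ∃ c : K, IsIntegral F c ∧ ℓ ∣ (minpoly F c).natDegree := by
  have hirr := X_pow_sub_C_irreducible_of_prime hℓ ha
  have hmon : (X ^ ℓ - C a).Monic := monic_X_pow_sub_C a hℓ.ne_zero
  have hdeg : (X ^ ℓ - C a).degree ≠ 0 := by
    rw [degree_X_pow_sub_C hℓ.pos]; exact_mod_cast hℓ.ne_zero
  obtain ⟨c, hc⟩ := IsAlgClosed.exists_aeval_eq_zero K _ hdeg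
  refine ⟨c, ⟨_, hmon, hc⟩, ?_⟩
  rw [← minpoly.eq_of_irreducible_of_monic hirr hc hmon, natDegree_X_pow_sub_C]

/-- The generator t is not an ℓ-th power in F(t), so its ℓ-th root has degree ℓ. Nothing is needed
of F. -/
theorem adjoin_of_transcendental {F K : Type*} [Field F] [Field K] [Algebra F K] [IsAlgClosed K]
    {t : K} (ht : Transcendental F t) : HasLargePrimeDegrees F⟮t⟯ K := by
  refine ⟨0, fun ℓ hℓ _ => exists_of_forall_pow_ne hℓ (a := AdjoinSimple.gen F t) fun b hb => ?_⟩
  obtain ⟨r, s, hrs⟩ := (mem_adjoin_simple_iff F (b : K)).1 b.2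
  have hinj := transcendental_iff_injective.1 ht
  have ht0 : t ≠ 0 := fun h => ht (h ▸ isAlgebraic_zero)
  have hb' : (b : K) ^ ℓ = t := by
    have := congrArg (algebraMap F⟮t⟯ K) hb
    simpa using this
  have hs0 : aeval t s ≠ 0 := by
    intro h
    rw [h, div_zero] at hrs
    rw [hrs, zero_pow hℓ.ne_zero] at hb'
    exact ht0 hb'.symm
  rw [hrs, div_pow, div_eq_iff (pow_ne_zero _ hs0)] at hb'
  have hpoly : r ^ ℓ = X * s ^ ℓ := hinj (by simpa using hb')
  have hs : s ≠ 0 := fun h => hs0 (by simp [h])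
  -- Comparing degrees gives ℓ · deg r = ℓ · deg s + 1.
  have := congrArg natDegree hpoly
  rw [natDegree_pow, natDegree_X_mul (pow_ne_zero _ hs), natDegree_pow] at this
  have h1 : ℓ ∣ 1 := (Nat.dvd_add_right (Dvd.intro _ rfl)).1 (this ▸ Dvd.intro _ rfl)
  exact hℓ.one_lt.ne' (Nat.dvd_one.1 h1)

theorem adjoin_simple {F K : Type*} [Field F] [Field K] [Algebra F K] [IsAlgClosed K]
    (h : HasLargePrimeDegrees F K) (t : K) : HasLargePrimeDegrees F⟮t⟯ K := by
  by_cases ht : IsAlgebraic F t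
  · have := adjoin.finiteDimensional ht.isIntegral
    exact h.of_finiteDimensional
  · exact adjoin_of_transcendental ht

theorem adjoin_finset {F K : Type*} [Field F] [Field K] [Algebra F K] [IsAlgClosed K]
    (h : HasLargePrimeDegrees F K) (S : Finset K) :
    HasLargePrimeDegrees (IntermediateField.adjoin F (S : Set K)) K :=
  induction_on_adjoin_finset S (fun L => HasLargePrimeDegrees L K) h.of_finiteDimensional
    fun _ x _ hL => hL.adjoin_simple x

theorem rat (K : Type*) [Field K] [CharZero K] [IsAlgClosed K] : HasLargePrimeDegrees ℚ K := by
  refine ⟨0, fun ℓ hℓ _ => exists_of_forall_pow_ne hℓ (a := 2) fun b hb => ?_⟩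
  -- The 2-adic valuation of b ^ ℓ is a multiple of ℓ, while that of 2 is 1.
  have h1 := congrArg (padicValRat 2) hb
  have hb0 : b ≠ 0 := by
    rintro rfl
    rw [zero_pow hℓ.ne_zero] at hb
    norm_num at hb
  rw [padicValRat.pow, show (2 : ℚ) = ((2 : ℕ) : ℚ) by norm_num,
    padicValRat.self (by norm_num)] at h1
  have : (ℓ : ℤ) ∣ 1 := ⟨_, h1.symm⟩
  exact hℓ.one_lt.ne' (by exact_mod_cast Int.eq_one_of_dvd_one (by positivity) this)

/-- Radicals need not help over a finite field, where every element may be an ℓ-th power; a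
generator of the field with p ^ ℓ elements is used instead. -/
theorem zmod (p : ℕ) [Fact p.Prime] (K : Type*) [Field K] [Algebra (ZMod p) K] [IsAlgClosed K] :
    HasLargePrimeDegrees (ZMod p) K := by
  refine ⟨0, fun ℓ hℓ _ => ?_⟩
  let e : GaloisField p ℓ →ₐ[ZMod p] K := IsAlgClosed.lift
  obtain ⟨α, hα⟩ := Field.exists_primitive_element (ZMod p) (GaloisField p ℓ)
  have hint : IsIntegral (ZMod p) α := Algebra.IsIntegral.isIntegral α
  refine ⟨e α, hint.map e, ?_⟩
  rw [minpoly.algHom_eq e e.injective, ← adjoin.finrank hint, hα, finrank_top',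
    GaloisField.finrank p hℓ.ne_zero]

theorem exists_subfield (K : Type*) [Field K] [IsAlgClosed K] {S : Set K} (hS : S.Finite) :
    ∃ k₀ : Subfield K, S ⊆ k₀ ∧ HasLargePrimeDegrees k₀ K := by
  lift S to Finset K using hS
  obtain ⟨p, hp⟩ := CharP.exists K
  obtain hp0 | rfl := CharP.char_is_prime_or_zero K p
  · have : Fact p.Prime := ⟨hp0⟩
    let : Algebra (ZMod p) K := ZMod.algebra K p
    exact ⟨(IntermediateField.adjoin (ZMod p) (S : Set K)).toSubfield, subset_adjoin _ _,
      (zmod p K).adjoin_finset S⟩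
  · have : CharZero K := CharP.charP_to_charZero K
    exact ⟨(IntermediateField.adjoin ℚ (S : Set K)).toSubfield, subset_adjoin _ _,
      (rat K).adjoin_finset S⟩

end HasLargePrimeDegrees

/-! ### Extensions whose degrees have only small prime factors -/

section SmoothDegrees

open Polynomial IntermediateField

/-- The elements of `K` contained in a finite extension of `k₀` whose degree only has prime
factors at most `d`. -/
def smoothDegreeElements {K : Type*} [Field K] (k₀ : Subfield K) (d : ℕ) : Set K :=
  {a | ∃ L : IntermediateField k₀ K, FiniteDimensional k₀ L ∧
    (∀ ℓ : ℕ, ℓ.Prime → ℓ ∣ Module.finrank k₀ L → ℓ ≤ d) ∧ a ∈ L}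

variable {K : Type*} [Field K] {k₀ : Subfield K} {d : ℕ}

theorem mem_smoothDegreeElements_of_mem {a : K} (ha : a ∈ k₀) :
    a ∈ smoothDegreeElements k₀ d := by
  refine ⟨⊥, inferInstance, fun ℓ hℓ h => ?_, mem_bot.2 ⟨⟨a, ha⟩, rfl⟩⟩
  rw [IntermediateField.finrank_bot] at h
  exact absurd (Nat.dvd_one.1 h) hℓ.one_lt.ne'

/-- If a lies in L, then b is a root of a non-zero polynomial over L of degree at most d, so passing
from L to L(b) multiplies the degree by a number at most d, all of whose prime factors are at most
d. -/
theorem mem_smoothDegreeElements_of_root {F : K[X][X]} (hF : ∀ i j, (F.coeff i).coeff j ∈ k₀)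
    (hd : F.natDegree ≤ d) {a b : K} (ha : a ∈ smoothDegreeElements k₀ d)
    (h0 : F.map (evalRingHom a) ≠ 0) (hb : (F.map (evalRingHom a)).eval b = 0) :
    b ∈ smoothDegreeElements k₀ d := by
  obtain ⟨L, hL, hdvd, haL⟩ := ha
  have hcoeff : ∀ i, (F.map (evalRingHom a)).coeff i ∈ (algebraMap L K).range := by
    intro i
    rw [coeff_map, coe_evalRingHom, eval_eq_sum_range]
    have : ∑ j ∈ Finset.range ((F.coeff i).natDegree + 1), (F.coeff i).coeff j * a ^ j ∈ L :=
      sum_mem fun j _ => mul_mem (L.algebraMap_mem ⟨_, hF i j⟩) (pow_mem haL j)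
    exact ⟨⟨_, this⟩, rfl⟩
  obtain ⟨q, hq⟩ := (mem_lifts _).1 ((lifts_iff_coeff_lifts (f := algebraMap L K) _).2 hcoeff)
  have hq0 : q ≠ 0 := by
    rintro rfl
    exact h0 (by rw [← hq, Polynomial.map_zero])
  have hqb : aeval b q = 0 := by rw [aeval_def, ← Polynomial.eval_map, hq, hb]
  have hint : IsIntegral L b := (isAlgebraic_iff_isIntegral).1 ⟨q, hq0, hqb⟩
  have hdeg : (minpoly L b).natDegree ≤ d := by
    refine (natDegree_le_of_dvd (minpoly.dvd L b hqb) hq0).trans ?_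
    rw [← natDegree_map (algebraMap L K), hq]
    exact natDegree_map_le.trans hd
  refine ⟨L⟮b⟯.restrictScalars k₀, IntermediateField.finiteDimensional_adjoin_simple hint,
    fun ℓ hℓ h => ?_, mem_adjoin_simple_self L b⟩
  rw [IntermediateField.finrank_adjoin_simple hint] at h
  obtain h4 | h4 := (Nat.Prime.dvd_mul hℓ).1 h
  · exact hdvd ℓ hℓ h4
  · exact (Nat.le_of_dvd (minpoly.natDegree_pos hint) h4).trans hdeg

theorem HasLargePrimeDegrees.exists_notMem_smoothDegreeElements
    (h : HasLargePrimeDegrees k₀ K) (d : ℕ) : ∃ c : K, c ∉ smoothDegreeElements k₀ d := by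
  obtain ⟨N, hN⟩ := h
  obtain ⟨ℓ, hle, hℓ⟩ := Nat.exists_infinite_primes (max N d + 1)
  obtain ⟨c, hc, hdvd⟩ := hN ℓ hℓ (lt_of_le_of_lt (le_max_left _ _) hle)
  refine ⟨c, fun ⟨L, _, hL, hcL⟩ => ?_⟩
  have h1 := finrank_dvd_of_le_right (adjoin_simple_le_iff.2 hcL)
  rw [adjoin.finrank hc] at h1
  exact absurd (lt_of_le_of_lt (le_max_right N d) hle) (not_lt.2 (hL ℓ hℓ (hdvd.trans h1)))

end SmoothDegrees

/-! ### Complete sets, and infinitely many irreducible ones -/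

namespace DirectedGraph

variable {Γ : DirectedGraph.{u}}

theorem isComplete_iff {S : Set Γ.V} :
    Γ.IsComplete S ↔ ∀ z : Γ.Z, Γ.s z ∈ S ↔ Γ.t z ∈ S := by
  refine ⟨fun h z => ⟨fun hz => h.1 _ hz _ ⟨z, rfl, rfl⟩, fun hz => h.2 _ hz _ ⟨z, rfl, rfl⟩⟩,
    fun h => ⟨?_, ?_⟩⟩
  · rintro x hx y ⟨z, rfl, rfl⟩
    exact (h z).1 hx
  · rintro x hx y ⟨z, rfl, rfl⟩
    exact (h z).2 hx

theorem IsIrreducibleComplete.subset {S T : Set Γ.V} (hS : Γ.IsIrreducibleComplete S)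
    (hT : Γ.IsComplete T) {x : Γ.V} (hxS : x ∈ S) (hxT : x ∈ T) : S ⊆ T := by
  by_contra hST
  refine hS.2.2 (S ∩ T) ⟨Set.inter_subset_left, fun h => hST fun y hy => (h hy).2⟩
    ⟨x, hxS, hxT⟩ ?_
  have h1 := isComplete_iff.1 hS.1
  have h2 := isComplete_iff.1 hT
  exact isComplete_iff.2 fun z => and_congr (h1 z) (h2 z)

theorem IsIrreducibleComplete.eq {S T : Set Γ.V} (hS : Γ.IsIrreducibleComplete S)
    (hT : Γ.IsIrreducibleComplete T) {x : Γ.V} (hxS : x ∈ S) (hxT : x ∈ T) : S = T :=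
  (hS.subset hT.1 hxS hxT).antisymm (hT.subset hS.1 hxT hxS)

/-- The intersection of all complete sets containing x works: complements of complete sets are
complete, so a complete subset either contains x, and is everything, or has a complement containing
the whole intersection, and is empty. -/
theorem exists_isIrreducibleComplete (x : Γ.V) :
    ∃ S : Set Γ.V, Γ.IsIrreducibleComplete S ∧ x ∈ S := by
  refine ⟨⋂₀ {T | Γ.IsComplete T ∧ x ∈ T}, ⟨?_, ⟨x, fun T hT => hT.2⟩, ?_⟩, fun T hT => hT.2⟩
  · refine isComplete_iff.2 fun z => forall₂_congr fun T hT => isComplete_iff.1 hT.1 z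
  · intro T hT ⟨y, hy⟩ hTc
    have hTc' := isComplete_iff.1 hTc
    by_cases hx : x ∈ T
    · exact hT.2 fun w hw => hw T ⟨hTc, hx⟩
    · exact hT.1 hy Tᶜ ⟨isComplete_iff.2 fun z => not_congr (hTc' z), hx⟩ hy

theorem finite_setOf_isIrreducibleComplete_inter {B : Set Γ.V} (hB : B.Finite) :
    {S : Set Γ.V | Γ.IsIrreducibleComplete S ∧ (S ∩ B).Nonempty}.Finite := by
  choose f hf using exists_isIrreducibleComplete (Γ := Γ)
  refine (hB.image f).subset ?_
  rintro S ⟨hS, x, hxS, hxB⟩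
  exact ⟨x, hxB, (hf x).1.eq hS (hf x).2 hxS⟩

open Polynomial

/-- The vertices `x` and `y` have coordinates `a` and `b` with `b` a root of the non-zero polynomial
`F(a, Y)` for some `F` in the set `E`. -/
def PolyRelated {V K : Type*} [Field K] (R : V → K → Prop) (E : Set K[X][X]) (x y : V) : Prop :=
  ∃ F ∈ E, ∃ a b, R x a ∧ R y b ∧ F.map (evalRingHom a) ≠ 0 ∧ (F.map (evalRingHom a)).eval b = 0

theorem PolyRelated.mono {V K : Type*} [Field K] {R : V → K → Prop} {E E' : Set K[X][X]}
    (h : E ⊆ E') {x y : V} (hxy : PolyRelated R E x y) : PolyRelated R E' x y :=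
  hxy.imp fun _ => And.imp_left fun hF => h hF

/-- The graph-theoretic core. `R` is a partial coordinate function, written as a relation because an
affine chart need not contain all vertices. -/
theorem infinite_setOf_isIrreducibleComplete {K : Type*} [Field K] [IsAlgClosed K]
    {R : Γ.V → K → Prop} (hR : ∀ x a b, R x a → R x b → a = b)
    (hfin : {a | ∀ x, ¬ R x a}.Finite) {E : Set K[X][X]} (hE : E.Finite)
    (hst : {z | ¬ PolyRelated R E (Γ.s z) (Γ.t z)}.Finite)
    (hts : {z | ¬ PolyRelated R E (Γ.t z) (Γ.s z)}.Finite) :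
    {S : Set Γ.V | Γ.IsIrreducibleComplete S}.Infinite := by
  intro hirr
  have hval : ∀ {B : Set Γ.V}, B.Finite → {a | ∃ x ∈ B, R x a}.Finite := by
    intro B hB
    have : {a | ∃ x ∈ B, R x a} = ⋃ x ∈ B, {a | R x a} := by ext; simp
    rw [this]
    exact hB.biUnion fun x _ => Set.Subsingleton.finite fun a ha b hb => hR x a b ha hb
  have hne : ∀ S : {S : Set Γ.V | Γ.IsIrreducibleComplete S}, ∃ x, x ∈ S.1 := fun S => S.2.2.1
  choose r hr using hne
  have : Finite {S : Set Γ.V | Γ.IsIrreducibleComplete S} := hirr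
  -- The data to be put in k₀: values that are nobody's coordinate, coordinates of the
  -- representatives, of the targets and the sources of exceptional edges, and coefficients of the
  -- relations.
  have hS : ({a | ∀ x, ¬ R x a} ∪ {a | ∃ x ∈ Set.range r, R x a} ∪
      {a | ∃ x ∈ Γ.t '' {z | ¬ PolyRelated R E (Γ.s z) (Γ.t z)}, R x a} ∪
      {a | ∃ x ∈ Γ.s '' {z | ¬ PolyRelated R E (Γ.t z) (Γ.s z)}, R x a} ∪
      ⋃ F ∈ E, ⋃ i ∈ F.support, ((F.coeff i).coeffs : Set K)).Finite :=
    (((hfin.union (hval (Set.finite_range r))).union (hval (hst.image _))).union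
      (hval (hts.image _))).union
      (hE.biUnion fun F _ => F.support.finite_toSet.biUnion fun i _ => Finset.finite_toSet _)
  obtain ⟨k₀, hk₀, hlarge⟩ := HasLargePrimeDegrees.exists_subfield K hS
  simp only [Set.union_subset_iff] at hk₀
  obtain ⟨⟨⟨⟨hk₁, hk₂⟩, hk₃⟩, hk₄⟩, hk₅⟩ := hk₀
  have hcoeff : ∀ F ∈ E, ∀ i j, (F.coeff i).coeff j ∈ k₀ := by
    intro F hF i j
    by_cases hij : (F.coeff i).coeff j = 0
    · rw [hij]; exact zero_mem _
    · have hi : F.coeff i ≠ 0 := fun h => hij (by rw [h, coeff_zero])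
      exact hk₅ (Set.mem_biUnion hF (Set.mem_biUnion (mem_support_iff.2 hi)
        (coeff_mem_coeffs hij)))
  obtain ⟨d, hd⟩ := (hE.image natDegree).bddAbove
  have hdeg : ∀ F ∈ E, F.natDegree ≤ d := fun F hF => hd ⟨F, hF, rfl⟩
  let D := smoothDegreeElements k₀ d
  have hrel : ∀ x y, PolyRelated R E x y → (∀ a, R x a → a ∈ D) → ∀ b, R y b → b ∈ D := by
    rintro x y ⟨F, hF, a, b, hxa, hyb, h0, hb⟩ hx b' hyb'
    obtain rfl := hR y b b' hyb hyb'
    exact mem_smoothDegreeElements_of_root (hcoeff F hF) (hdeg F hF) (hx a hxa) h0 hb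
  -- Vertices without a coordinate belong to this set vacuously. At an exceptional edge the endpoint
  -- to be reached has its coordinate, if any, already in k₀.
  have hcomplete : Γ.IsComplete {x | ∀ a, R x a → a ∈ D} := by
    refine isComplete_iff.2 fun z => ⟨fun hz => ?_, fun hz => ?_⟩
    · by_cases h : PolyRelated R E (Γ.s z) (Γ.t z)
      · exact hrel _ _ h hz
      · exact fun a ha => mem_smoothDegreeElements_of_mem (hk₃ ⟨_, ⟨z, h, rfl⟩, ha⟩)
    · by_cases h : PolyRelated R E (Γ.t z) (Γ.s z)
      · exact hrel _ _ h hz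
      · exact fun a ha => mem_smoothDegreeElements_of_mem (hk₄ ⟨_, ⟨z, h, rfl⟩, ha⟩)
  obtain ⟨c, hc⟩ := hlarge.exists_notMem_smoothDegreeElements d
  by_cases hcR : ∃ x, R x c
  · obtain ⟨x, hx⟩ := hcR
    obtain ⟨S, hS, hxS⟩ := exists_isIrreducibleComplete x
    have hrS := hr ⟨S, hS⟩
    exact hc (hS.subset hcomplete hrS
      (fun a ha => mem_smoothDegreeElements_of_mem (hk₂ ⟨_, ⟨⟨S, hS⟩, rfl⟩, ha⟩)) hxS c hx)
  · exact hc (mem_smoothDegreeElements_of_mem (hk₁ (not_exists.1 hcR)))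

end DirectedGraph

/-! ### Quasi-finite and étale algebras over domains -/

section QuasiFinite

open Polynomial TensorProduct

theorem algebraMap_injective_of_flat (R B : Type*) [CommRing R] [IsDomain R] [CommRing B]
    [Nontrivial B] [Algebra R B] [Module.Flat R B] :
    Function.Injective (algebraMap R B) := by
  have := Module.Flat.isTorsionFree (R := R) (M := B)
  exact FaithfulSMul.algebraMap_injective R B

theorem Algebra.QuasiFinite.isAlgebraic (R B : Type*) [CommRing R] [IsDomain R] [CommRing B]
    [IsDomain B] [Algebra R B] [FaithfulSMul R B] [Algebra.QuasiFinite R B] :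
    Algebra.IsAlgebraic R B := by
  have : Algebra.QuasiFinite R (FractionRing B) :=
    Algebra.QuasiFinite.of_isLocalization (S := B) (nonZeroDivisors B)
  have : FaithfulSMul R (FractionRing B) := (faithfulSMul_iff_algebraMap_injective _ _).2 <| by
    rw [IsScalarTower.algebraMap_eq R B (FractionRing B)]
    exact (IsFractionRing.injective B _).comp (FaithfulSMul.algebraMap_injective R B)
  let := FractionRing.liftAlgebra R (FractionRing B)
  have := FractionRing.isScalarTower_liftAlgebra R (FractionRing B)
  have : Algebra.QuasiFinite (FractionRing R) (FractionRing B) := .of_restrictScalars R _ _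
  have : Module.Finite (FractionRing R) (FractionRing B) := .of_quasiFinite
  have h : Algebra.IsAlgebraic R (FractionRing B) :=
    (IsFractionRing.comap_isAlgebraic_iff (K := FractionRing R)).2 inferInstance
  exact ⟨fun b => (isAlgebraic_algebraMap_iff (IsFractionRing.injective B (FractionRing B))).1
    (h.isAlgebraic _)⟩

/-- By flatness B embeds in its base change to the fraction field of R, and an étale algebra over a
field is reduced. -/
theorem isReduced_of_etale (R B : Type*) [CommRing R] [IsDomain R] [CommRing B] [Algebra R B]
    [Algebra.Etale R B] : IsReduced B := by
  let K := FractionRing R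
  have : IsReduced (K ⊗[R] B) := Algebra.FormallyUnramified.isReduced_of_field K (K ⊗[R] B)
  have hinj : Function.Injective (Algebra.TensorProduct.includeRight : B →ₐ[R] K ⊗[R] B) :=
    Algebra.TensorProduct.includeRight_injective (IsFractionRing.injective R K)
  exact isReduced_of_injective _ hinj

theorem isDomain_of_etale (R B : Type*) [CommRing R] [IsDomain R] [CommRing B] [Algebra R B]
    [Algebra.Etale R B] [IrreducibleSpace (PrimeSpectrum B)] : IsDomain B := by
  have := isReduced_of_etale R B
  have := (PrimeSpectrum.irreducibleSpace_iff_isPrime_nilradical).1 ‹_›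
  rw [nilradical_eq_zero] at this
  exact (IsDomain.of_bot_isPrime B)

theorem Algebra.QuasiFinite.exists_ringHom_comp_eq_of_injective {A B K : Type*} [CommRing A]
    [IsDomain A] [CommRing B] [IsDomain B] [Algebra A B] [FaithfulSMul A B]
    [Algebra.QuasiFinite A B] [Field K] [IsAlgClosed K] (φ : A →+* K)
    (hφ : Function.Injective φ) : ∃ g : B →+* K, g.comp (algebraMap A B) = φ := by
  have := Algebra.QuasiFinite.isAlgebraic A B
  let := φ.toAlgebra
  have : FaithfulSMul A K := (faithfulSMul_iff_algebraMap_injective _ _).2 hφ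
  obtain ⟨g⟩ : Nonempty (B →ₐ[A] K) := ⟨IsAlgClosed.lift⟩
  exact ⟨g.toRingHom, g.comp_algebraMap⟩

/-- Modulo q the extension is one of domains and algebraic, so an embedding of the base into K
extends. -/
theorem Algebra.QuasiFinite.exists_ringHom_comp_eq {R B K : Type*} [CommRing R] [CommRing B]
    [Algebra R B] [Algebra.QuasiFinite R B] [Field K] [IsAlgClosed K] (φ : R →+* K) (q : Ideal B)
    [q.IsPrime] (hq : q.comap (algebraMap R B) = RingHom.ker φ) :
    ∃ g : B →+* K, g.comp (algebraMap R B) = φ := by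
  have : FaithfulSMul (R ⧸ q.under R) (B ⧸ q) :=
    (faithfulSMul_iff_algebraMap_injective _ _).2 Ideal.algebraMap_quotient_injective
  have : Algebra.QuasiFinite (R ⧸ q.under R) (B ⧸ q) := .of_restrictScalars R _ _
  let ψ : R ⧸ q.under R →+* K := Ideal.Quotient.lift _ φ fun a ha => hq.le ha
  have hψ : Function.Injective ψ := RingHom.lift_injective_of_ker_le_ideal _ _ hq.ge
  obtain ⟨g, hg⟩ := exists_ringHom_comp_eq_of_injective (B := B ⧸ q) ψ hψ
  exact ⟨g.comp (Ideal.Quotient.mk q), RingHom.ext fun x => congr($hg (Ideal.Quotient.mk _ x))⟩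

theorem Polynomial.trdeg_eq_one_of_isAlgebraic (k B : Type*) [Field k] [CommRing B] [IsDomain B]
    [Algebra k B] [Algebra k[X] B] [IsScalarTower k k[X] B] [FaithfulSMul k[X] B]
    [Algebra.IsAlgebraic k[X] B] : Algebra.trdeg k B = 1 := by
  have h := lift_trdeg_add_eq k k[X] B
  rw [trdeg_eq_zero (R := k[X]) (A := B), Polynomial.trdeg_of_isDomain] at h
  simpa using h.symm

theorem Polynomial.isAlgebraic_of_trdeg_eq_one (k B : Type*) [Field k] [CommRing B] [IsDomain B]
    [Algebra k B] [Algebra k[X] B] [IsScalarTower k k[X] B] [FaithfulSMul k[X] B]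
    (hB : Algebra.trdeg k B = 1) : Algebra.IsAlgebraic k[X] B := by
  have h := lift_trdeg_add_eq k k[X] B
  rw [hB, Polynomial.trdeg_of_isDomain] at h
  simp only [Cardinal.lift_one] at h
  have h0 : Algebra.trdeg k[X] B = 0 := by
    have h1 : (1 : Cardinal) + Cardinal.lift (Algebra.trdeg k[X] B) = 1 + 0 := by simpa using h
    have h2 := Cardinal.eq_of_add_eq_add_left h1 Cardinal.one_lt_aleph0
    simpa using h2
  exact trdeg_eq_zero_iff.1 h0

end QuasiFinite

/-! ### Étale domains over k[X] as coordinate rings of curves -/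

namespace EtalePolynomial

open Polynomial

section

variable (k B : Type*) [Field k] [CommRing B] [Algebra k[X] B] [Algebra.Etale k[X] B] [IsDomain B]

instance : FaithfulSMul k[X] B :=
  (faithfulSMul_iff_algebraMap_injective _ _).2 (algebraMap_injective_of_flat _ _)

theorem isAlgebraic : Algebra.IsAlgebraic k[X] B := Algebra.QuasiFinite.isAlgebraic _ _

end

variable (k : Type*) {B : Type*} [Field k] [CommRing B] [Algebra k B] [Algebra k[X] B]
  [IsScalarTower k k[X] B] [Algebra.Etale k[X] B] [IsDomain B]

/-- Since B is algebraic over k[X], a non-zero ideal contains a non-zero polynomial h; the quotient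
is then quasi-finite over a quotient of k[X]/(h), hence finite over k. -/
theorem finite_quotient {I : Ideal B} (hI : I ≠ ⊥) : Module.Finite k (B ⧸ I) := by
  obtain ⟨b, hbI, hb0⟩ := Submodule.exists_mem_ne_zero_of_ne_bot hI
  have hne := Ideal.comap_ne_bot_of_algebraic_mem hb0 hbI ((isAlgebraic k B).isAlgebraic b)
  obtain ⟨h, hhI, hh0⟩ := Submodule.exists_mem_ne_zero_of_ne_bot hne
  let J : Ideal k[X] := I.under k[X]
  have hle : Ideal.span {h} ≤ J := (Ideal.span_singleton_le_iff_mem _).2 hhI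
  have : Module.Finite k (k[X] ⧸ Ideal.span {h}) := (AdjoinRoot.powerBasis hh0).finite
  have : Module.Finite k (k[X] ⧸ J) :=
    .of_surjective (Ideal.Quotient.factorₐ k hle).toLinearMap (Ideal.Quotient.factor_surjective hle)
  have : Algebra.QuasiFinite (k[X] ⧸ J) (B ⧸ I) := .of_restrictScalars k[X] _ _
  have : Algebra.QuasiFinite k (B ⧸ I) := .trans k (k[X] ⧸ J) (B ⧸ I)
  exact .of_quasiFinite

omit [Algebra k B] [IsScalarTower k k[X] B] in
include k in
theorem isMaximal_of_ne_bot {P : Ideal B} [P.IsPrime] (hP : P ≠ ⊥) : P.IsMaximal := by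
  let : Algebra k B := ((algebraMap k[X] B).comp (algebraMap k k[X])).toAlgebra
  have : IsScalarTower k k[X] B := .of_algebraMap_eq' rfl
  have := finite_quotient k hP
  have : IsField (B ⧸ P) := isField_of_isIntegral_of_isField' (R := k) (Field.toIsField k)
  exact Ideal.Quotient.maximal_of_isField P this

theorem finite_algHom {K : Type*} [Field K] [Algebra k K] {I : Ideal B} (hI : I ≠ ⊥) :
    {h : B →ₐ[k] K | I ≤ RingHom.ker h}.Finite := by
  have := finite_quotient k hI
  refine (Set.finite_range fun g : (B ⧸ I) →ₐ[k] K => g.comp (Ideal.Quotient.mkₐ k I)).subset ?_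
  intro h hh
  exact ⟨Ideal.Quotient.liftₐ I h hh, by ext; rfl⟩

variable (B)

/-- The map from Spec B to the line is open, so its image contains a basic open set D(f) with f ≠ 0,
and only roots of f can be missed. -/
theorem finite_setOf_forall_ne (K : Type*) [Field K] [IsAlgClosed K] [Algebra k K] :
    {a : K | ∀ h : B →ₐ[k] K, h (algebraMap k[X] B X) ≠ a}.Finite := by
  have hopen : IsOpen (Set.range (PrimeSpectrum.comap (algebraMap k[X] B))) := by
    have : Algebra.HasGoingDown k[X] B := .of_flat
    exact (PrimeSpectrum.isOpenMap_comap_of_hasGoingDown_of_finitePresentation).isOpen_range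
  have hne : (Set.range (PrimeSpectrum.comap (algebraMap k[X] B))).Nonempty := Set.range_nonempty _
  obtain ⟨p, hp⟩ := hne
  obtain ⟨_, ⟨_, ⟨f, rfl⟩, rfl⟩, hpf, hf⟩ :=
    PrimeSpectrum.isBasis_basic_opens.exists_subset_of_mem_open hp hopen
  have hf0 : f ≠ 0 := fun h => by simp [h] at hpf
  refine (f.rootSet_finite K).subset fun a ha => ?_
  by_contra hroot
  have hfa : aeval a f ≠ 0 := fun h => hroot (mem_rootSet.2 ⟨hf0, h⟩)
  let φ : k[X] →ₐ[k] K := aeval a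
  have hprime : (RingHom.ker φ).IsPrime := RingHom.ker_isPrime _
  obtain ⟨q, hq⟩ := hf (show (⟨RingHom.ker φ, hprime⟩ : PrimeSpectrum k[X]) ∈ _ from hfa)
  obtain ⟨g, hg⟩ := Algebra.QuasiFinite.exists_ringHom_comp_eq φ.toRingHom q.asIdeal
    (congrArg PrimeSpectrum.asIdeal hq)
  have hg' : ∀ x, g (algebraMap k[X] B x) = φ x := fun x => congr($hg x)
  let h : B →ₐ[k] K :=
    { toRingHom := g
      commutes' := fun x => by
        rw [IsScalarTower.algebraMap_apply k k[X] B]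
        exact (hg' _).trans (φ.commutes x) }
  exact ha h ((hg' X).trans (aeval_X a))

/-- As B has transcendence degree 1, t₂ is algebraic over k[t₁]. Taking b to be a non-zero
coefficient of the relation ensures that the relation stays non-trivial wherever b does not vanish.
-/
theorem exists_relation {t₁ : B} (ht₁ : Transcendental k t₁) (t₂ : B) :
    ∃ (F : k[X][X]) (b : B), b ≠ 0 ∧
      ∀ (K : Type*) [Field K] [Algebra k K] (h : B →ₐ[k] K), h b ≠ 0 →
        (F.map (mapRingHom (algebraMap k K))).map (evalRingHom (h t₁)) ≠ 0 ∧
        ((F.map (mapRingHom (algebraMap k K))).map (evalRingHom (h t₁))).eval (h t₂) = 0 := by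
  have := isAlgebraic k B
  have htr := Polynomial.trdeg_eq_one_of_isAlgebraic k B
  -- Here B is a k[X]-algebra through X ↦ t₁, in place of its étale structure.
  have halg : letI := (aeval (R := k) t₁).toRingHom.toAlgebra; Algebra.IsAlgebraic k[X] B := by
    clear * - htr ht₁
    let := (aeval (R := k) t₁).toRingHom.toAlgebra
    have : IsScalarTower k k[X] B := .of_algebraMap_eq fun x => ((aeval t₁).commutes x).symm
    have : FaithfulSMul k[X] B := (faithfulSMul_iff_algebraMap_injective _ _).2
      (transcendental_iff_injective.1 ht₁)
    exact Polynomial.isAlgebraic_of_trdeg_eq_one k B htr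
  obtain ⟨F, hF0, hF⟩ := halg.isAlgebraic t₂
  obtain ⟨n, hn⟩ : ∃ n, F.coeff n ≠ 0 := by
    by_contra! h
    exact hF0 (Polynomial.ext h)
  refine ⟨F, aeval t₁ (F.coeff n), fun h => hn ?_, fun K _ _ h hb => ?_⟩
  · exact (transcendental_iff_injective.1 ht₁) (by rw [h, map_zero])
  have hcomp : (evalRingHom (h t₁)).comp (mapRingHom (algebraMap k K)) =
      (h : B →+* K).comp (aeval (R := k) t₁ : k[X] →+* B) := by
    ext <;> simp
  rw [Polynomial.map_map, hcomp]
  refine ⟨fun h0 => hb ?_, ?_⟩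
  · have := congr(($h0).coeff n)
    simpa [coeff_map] using this
  · rw [← Polynomial.map_map, Polynomial.eval_map]
    have h1 : eval t₂ (F.map (aeval (R := k) t₁ : k[X] →+* B)) = 0 := by
      rw [Polynomial.eval_map]; exact hF
    have h2 := Polynomial.eval₂_at_apply (p := F.map (aeval (R := k) t₁ : k[X] →+* B))
      (h : B →+* K) t₂
    rw [h1, map_zero] at h2
    exact h2

end EtalePolynomial

/-! ### Étale charts of smooth schemes of relative dimension one -/

open Polynomial in
/-- An affine open subscheme `Spec B` of a `k`-scheme `X`, together with an étale `k`-algebra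
homomorphism `k[X] → B`. -/
structure EtaleChart {k : Type u} [Field k] {X : Scheme.{u}} (p : X ⟶ Spec (.of k)) where
  /-- the coordinate ring -/
  B : CommRingCat.{u}
  /-- the inclusion -/
  j : Spec B ⟶ X
  isOpenImmersion : IsOpenImmersion j
  /-- the étale homomorphism -/
  g : k[X] →+* B
  etale : g.Etale
  comp : j ≫ p = Spec.map (CommRingCat.ofHom (g.comp C))

noncomputable section

namespace EtaleChart

open Polynomial

section Existence

variable {k : Type u} [Field k] {X : Scheme.{u}} (p : X ⟶ Spec (.of k))

theorem exists_mem_range [hp : SmoothOfRelativeDimension 1 p] (x : X) :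
    ∃ c : EtaleChart p, x ∈ Set.range c.j := by
  obtain ⟨U, hU, V, hV, hxV, e, h⟩ := hp.exists_isStandardSmoothOfRelativeDimension x
  -- Spec k is a single point, so the affine open set in the base is everything.
  have hUtop : U = ⊤ := by
    refine top_le_iff.1 fun y _ => ?_
    have : Subsingleton (Spec (.of k)) := inferInstanceAs (Subsingleton (PrimeSpectrum k))
    rw [Subsingleton.elim y (p x)]
    exact e hxV
  subst hUtop
  have hsm := RingHom.isStandardSmoothOfRelativeDimension_respectsIso.right
    (p.appLE ⊤ V e).hom (Scheme.ΓSpecIso (.of k)).symm.commRingCatIsoToRingEquiv h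
  obtain ⟨g, hgC, hg⟩ := hsm.exists_etale_mvPolynomial
  have hj : hV.fromSpec ≫ p = Spec.map ((Scheme.ΓSpecIso (.of k)).inv ≫ p.appLE ⊤ V e) := by
    rw [← IsAffineOpen.SpecMap_appLE_fromSpec p (isAffineOpen_top _) hV e,
      IsAffineOpen.fromSpec_top, Scheme.isoSpec_Spec_inv, Spec.map_comp]
  refine ⟨⟨_, hV.fromSpec, inferInstance,
    g.comp (MvPolynomial.uniqueAlgEquiv k (Fin 1)).symm.toRingEquiv.toRingHom, ?_, ?_⟩, ?_⟩
  · exact RingHom.Etale.respectsIso.right _ _ hg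
  · rw [hj]
    congr 1
    ext x
    have := congr($hgC x)
    simp
    exact this.symm
  · rw [hV.range_fromSpec]; exact hxV

theorem exists_range_subset [SmoothOfRelativeDimension 1 p] {x : X} {W : X.Opens} (hx : x ∈ W) :
    ∃ c : EtaleChart p, x ∈ Set.range c.j ∧ Set.range c.j ⊆ W := by
  have : SmoothOfRelativeDimension 1 (W.ι ≫ p) :=
    inferInstanceAs (SmoothOfRelativeDimension (0 + 1) (W.ι ≫ p))
  obtain ⟨c, y, hy⟩ := exists_mem_range (W.ι ≫ p) ⟨x, hx⟩
  have := c.isOpenImmersion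
  refine ⟨⟨c.B, c.j ≫ W.ι, inferInstance, c.g, c.etale, by rw [Category.assoc, c.comp]⟩,
    ⟨y, ?_⟩, ?_⟩
  · rw [Scheme.Hom.comp_apply, hy]; rfl
  · rintro _ ⟨y, rfl⟩
    rw [Scheme.Hom.comp_apply]
    exact (c.j y).2

end Existence

variable {k : Type u} [Field k] {X : Scheme.{u}} {p : X ⟶ Spec (.of k)} (c : EtaleChart p)

instance : IsOpenImmersion c.j := c.isOpenImmersion
instance : Algebra k[X] c.B := c.g.toAlgebra
instance : Algebra k c.B := (c.g.comp C).toAlgebra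
instance : IsScalarTower k k[X] c.B := .of_algebraMap_eq' rfl
instance : Algebra.Etale k[X] c.B := c.etale

/-- The coordinate function of an étale chart. -/
def coord : c.B := algebraMap k[X] c.B Polynomial.X

theorem isReduced : _root_.IsReduced c.B := isReduced_of_etale k[X] c.B

theorem isDomain [IrreducibleSpace X] [Nonempty (Spec c.B)] : IsDomain c.B := by
  have : IrreducibleSpace (Spec c.B) := by
    have h : IsPreirreducible (c.j ⁻¹' Set.univ) :=
      (PreirreducibleSpace.isPreirreducible_univ).preimage c.j.isOpenEmbedding
    exact { isPreirreducible_univ := h, toNonempty := inferInstance }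
  have : IrreducibleSpace (PrimeSpectrum c.B) := this
  exact isDomain_of_etale k[X] c.B

theorem j_bot [IrreducibleSpace X] [IsDomain c.B] :
    c.j (⊥ : PrimeSpectrum c.B) = genericPoint X := by
  rw [← genericPoint_eq_of_isOpenImmersion c.j, genericPoint_eq_bot_of_affine]

section Points

variable {K : Type u} [Field K] [Algebra k K]

/-- The point of `X` underlying a `K`-point. -/
def _root_.KPoint.pt (x : KPoint K p) : X := x.1 (IsLocalRing.closedPoint K)

/-- The `K`-point attached to a homomorphism from the coordinate ring of a chart. -/
def toKPoint (h : c.B →ₐ[k] K) : KPoint K p :=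
  ⟨Spec.map (CommRingCat.ofHom h.toRingHom) ≫ c.j, by
    rw [Category.assoc, c.comp, ← Spec.map_comp, ← CommRingCat.ofHom_comp]
    congr 2
    exact h.comp_algebraMap⟩

theorem toKPoint_injective : Function.Injective (c.toKPoint (K := K)) := by
  intro h₁ h₂ h
  have h' := congrArg Subtype.val h
  simp only [toKPoint, cancel_mono] at h'
  have h'' := congrArg CommRingCat.Hom.hom (Spec.map_injective h')
  exact AlgHom.coe_ringHom_injective h''

theorem pt_toKPoint (h : c.B →ₐ[k] K) :
    (c.toKPoint h).pt = c.j ⟨RingHom.ker h, RingHom.ker_isPrime _⟩ := by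
  refine congrArg c.j (PrimeSpectrum.ext ?_)
  change (IsLocalRing.maximalIdeal K).comap h.toRingHom = _
  rw [IsLocalRing.isField_iff_maximalIdeal_eq.1 (Field.toIsField K)]
  rfl

theorem range_subset_of_pt_mem {x : KPoint K p} {S : Set X} (hx : x.pt ∈ S) :
    Set.range x.1 ⊆ S := by
  rintro _ ⟨y, rfl⟩
  have : Subsingleton (Spec (.of K)) := inferInstanceAs (Subsingleton (PrimeSpectrum K))
  rwa [Subsingleton.elim y (IsLocalRing.closedPoint K)]

theorem exists_toKPoint_eq {x : KPoint K p} (hx : x.pt ∈ Set.range c.j) :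
    ∃ h : c.B →ₐ[k] K, c.toKPoint h = x := by
  let f : Spec (.of K) ⟶ Spec c.B := IsOpenImmersion.lift c.j x.1 (range_subset_of_pt_mem hx)
  obtain ⟨φ, hφ⟩ := Spec.map_surjective f
  have hfac : Spec.map φ ≫ c.j = x.1 := by rw [hφ]; exact IsOpenImmersion.lift_fac _ _ _
  have hk : φ.hom.comp (c.g.comp C) = algebraMap k K := by
    have := x.2
    rw [← hfac, Category.assoc, c.comp, ← Spec.map_comp] at this
    exact congrArg CommRingCat.Hom.hom (Spec.map_injective this)
  exact ⟨⟨φ.hom, fun r => congr($hk r)⟩, Subtype.ext hfac⟩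

end Points

end EtaleChart

end

/-! ### Cofiniteness of open sets and generic points of curves -/

noncomputable section

theorem finite_of_forall_exists_mem_nhds {α X : Type*} [TopologicalSpace X] [CompactSpace X]
    (f : α → X) {S : Set α} (h : ∀ x, ∃ U ∈ nhds x, (S ∩ f ⁻¹' U).Finite) : S.Finite := by
  have := isCompact_univ.induction_on (X := X) (p := fun U => (S ∩ f ⁻¹' U).Finite) (by simp)
    (fun s t hst ht => ht.subset (Set.inter_subset_inter_right _ (Set.preimage_mono hst)))
    (fun s t hs ht => by rw [Set.preimage_union, Set.inter_union_distrib_left]; exact hs.union ht)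
    (fun x _ => by simpa using h x)
  simpa using this

section Curve

variable {k : Type u} [Field k] {X Y : Scheme.{u}} {p : X ⟶ Spec (.of k)} {q : Y ⟶ Spec (.of k)}

theorem IsCurve.irreducibleSpace (hp : IsCurve p) : IrreducibleSpace X := by
  have := hp.irreducible
  have : Subsingleton (Spec (.of k)) := inferInstanceAs (Subsingleton (PrimeSpectrum k))
  have : Nonempty (Spec (.of k)) := inferInstanceAs (Nonempty (PrimeSpectrum k))
  exact GeometricallyIrreducible.irreducibleSpace_of_subsingleton p

theorem IsCurve.compactSpace (hp : IsCurve p) : CompactSpace X := by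
  have := hp.proper
  exact QuasiCompact.compactSpace_of_compactSpace p

theorem genericPoint_mem [IrreducibleSpace X] {V : X.Opens} (hV : (V : Set X).Nonempty) :
    genericPoint X ∈ V :=
  ((genericPoint_spec X).mem_open_set_iff V.2).2 (by simpa using hV)

theorem isIntegral_of_smoothOfRelativeDimension_one [IrreducibleSpace X]
    [SmoothOfRelativeDimension 1 p] : IsIntegral X := by
  have : ∀ x : X, _root_.IsReduced (X.presheaf.stalk x) := by
    intro x
    obtain ⟨c, y, rfl⟩ := EtaleChart.exists_mem_range p x
    have := c.isReduced
    exact isReduced_of_injective (c.j.stalkMap y).hom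
      (ConcreteCategory.bijective_of_isIso (c.j.stalkMap y)).1
  have : IsReduced X := isReduced_of_isReduced_stalk X
  exact isIntegral_of_irreducibleSpace_of_isReduced X

theorem IsCurve.isIntegral (hp : IsCurve p) : IsIntegral X := by
  have := hp.irreducibleSpace
  have := hp.smooth
  exact isIntegral_of_smoothOfRelativeDimension_one (p := p)

/-- By compactness it is enough to work in one chart. The open set contains some D(b) with b ≠ 0
there, and the missed points factor through the finite k-algebra B/(b). -/
theorem IsCurve.finite_setOf_pt_notMem (hp : IsCurve p) (K : Type u) [Field K] [Algebra k K]
    {V : X.Opens} (hV : (V : Set X).Nonempty) : {x : KPoint K p | x.pt ∉ V}.Finite := by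
  have := hp.irreducibleSpace
  have := hp.compactSpace
  have := hp.smooth
  refine finite_of_forall_exists_mem_nhds KPoint.pt fun x => ?_
  obtain ⟨c, hx⟩ := EtaleChart.exists_mem_range p x
  refine ⟨Set.range c.j, c.j.isOpenEmbedding.isOpen_range.mem_nhds hx, ?_⟩
  have : Nonempty (Spec c.B) := ⟨hx.choose⟩
  have := c.isDomain
  have hbot : (⊥ : PrimeSpectrum c.B) ∈ c.j ⁻¹' (V : Set X) := by
    change c.j (⊥ : PrimeSpectrum c.B) ∈ (V : Set X)
    rw [c.j_bot]
    exact genericPoint_mem hV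
  obtain ⟨_, ⟨_, ⟨b, rfl⟩, rfl⟩, hb, hbV⟩ :=
    PrimeSpectrum.isBasis_basic_opens.exists_subset_of_mem_open hbot
      (V.2.preimage c.j.continuous)
  have hb0 : Ideal.span {b} ≠ ⊥ := by
    rw [Ne, Ideal.span_singleton_eq_bot]
    rintro rfl
    simp at hb
  refine ((EtalePolynomial.finite_algHom k (K := K) hb0).image c.toKPoint).subset ?_
  rintro z ⟨hzV, hz⟩
  obtain ⟨h, rfl⟩ := c.exists_toKPoint_eq hz
  refine ⟨h, (Ideal.span_singleton_le_iff_mem _).2 ?_, rfl⟩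
  by_contra hbh
  rw [Set.mem_ofPred_eq, c.pt_toKPoint] at hzV
  exact hzV (hbV hbh)

/-- Every f x is a specialization of the image of the generic point. If that image is not generic,
it is a maximal ideal in any chart around f x, so the two points agree and f is constant. -/
theorem IsCurve.map_genericPoint (hq : IsCurve q) [IrreducibleSpace X] {f : X ⟶ Y}
    (hf : IsNonconstant f) : IsGenericPoint (f (genericPoint X)) Set.univ := by
  have := hq.irreducibleSpace
  have := hq.smooth
  by_contra hne
  refine hf ⟨f (genericPoint X), fun x => ?_⟩
  have hspec : f (genericPoint X) ⤳ f x := (genericPoint_specializes x).map f.continuous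
  obtain ⟨c, y, hy⟩ := EtaleChart.exists_mem_range q (f x)
  obtain ⟨y', hy'⟩ : f (genericPoint X) ∈ Set.range c.j :=
    hspec.mem_open c.j.isOpenEmbedding.isOpen_range ⟨y, hy⟩
  rw [← hy, ← hy', c.j.isOpenEmbedding.isInducing.specializes_iff] at hspec
  have : Nonempty (Spec c.B) := ⟨y⟩
  have := c.isDomain
  have hy0 : (show PrimeSpectrum c.B from y').asIdeal ≠ ⊥ := by
    intro h0
    have : y' = (⊥ : PrimeSpectrum c.B) := PrimeSpectrum.ext h0
    rw [this, c.j_bot] at hy'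
    exact hne (hy' ▸ genericPoint_spec Y)
  have hmax := EtalePolynomial.isMaximal_of_ne_bot k hy0
  have hle := (PrimeSpectrum.le_iff_specializes _ _).2 hspec
  rw [← hy, ← hy']
  exact congrArg c.j (PrimeSpectrum.ext (hmax.eq_of_le y.2.ne_top hle).symm)

end Curve

/-! ### Separable morphisms are generically unramified -/

section Unramified

theorem exists_formallyUnramified_comp_of_stalkMap {X Y : Scheme.{u}} (f : X ⟶ Y)
    [LocallyOfFiniteType f] (x : X) (H : (f.stalkMap x).hom.FormallyUnramified) :
    ∃ (W : Scheme.{u}) (i : W ⟶ X), IsOpenImmersion i ∧ x ∈ Set.range i ∧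
      FormallyUnramified (i ≫ f) := by
  obtain ⟨_, ⟨U, hU, rfl⟩, hxU, -⟩ :=
    Y.isBasis_affineOpens.exists_subset_of_mem_open (Set.mem_univ (f x)) isOpen_univ
  obtain ⟨_, ⟨V, hV, rfl⟩, hxV, hVU⟩ :=
    X.isBasis_affineOpens.exists_subset_of_mem_open hxU (U.2.preimage f.continuous)
  have := hU.isOpenImmersion_fromSpec
  have := hV.isOpenImmersion_fromSpec
  have hft := f.finiteType_appLE hU hV hVU
  algebraize [(f.appLE U V hVU).hom]
  let P := (hU.primeIdealOf ⟨f x, hVU hxV⟩).asIdeal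
  let Q := (hV.primeIdealOf ⟨x, hxV⟩).asIdeal
  have : Q.LiesOver P :=
    ⟨congr($(IsAffineOpen.comap_primeIdealOf_appLE U hU V hV hVU hxV).1).symm⟩
  let := Localization.AtPrime.algebraOfLiesOver P Q
  have hPQ : Algebra.FormallyUnramified (Localization.AtPrime P) (Localization.AtPrime Q) := by
    rw [← RingHom.formallyUnramified_algebraMap]
    exact (RingHom.FormallyUnramified.respectsIso.arrow_mk_iso_iff
      (IsAffineOpen.arrowStalkMapIso f U hU V hV hVU hxV)).1 H
  have hQ : Algebra.IsUnramifiedAt Γ(Y, U) Q :=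
    Algebra.FormallyUnramified.comp Γ(Y, U) (Localization.AtPrime P) _
  obtain ⟨r, hrx, hr⟩ := Algebra.exists_formallyUnramified_of_isUnramifiedAt (R := Γ(Y, U)) Q
  let φ : Γ(X, V) ⟶ .of (Localization.Away r) := CommRingCat.ofHom (algebraMap _ _)
  have hφ : IsOpenImmersion (Spec.map φ) := inferInstance
  refine ⟨_, Spec.map φ ≫ hV.fromSpec, inferInstance, ?_, ?_⟩
  · have hmem : hV.primeIdealOf ⟨x, hxV⟩ ∈ Set.range (Spec.map φ) := by
      change _ ∈ Set.range (PrimeSpectrum.comap (algebraMap Γ(X, V) (Localization.Away r)))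
      rw [PrimeSpectrum.localization_away_comap_range _ r]
      exact hrx
    obtain ⟨y, hy⟩ := hmem
    refine ⟨y, ?_⟩
    rw [Scheme.Hom.comp_apply, hy]
    exact hV.fromSpec_primeIdealOf ⟨x, hxV⟩
  · rw [Category.assoc, ← IsAffineOpen.SpecMap_appLE_fromSpec f hU hV hVU, ← Spec.map_comp_assoc]
    have : FormallyUnramified (Spec.map (f.appLE U V hVU ≫ φ)) := by
      rw [HasRingHomProperty.Spec_iff (P := @FormallyUnramified)]
      rw [← RingHom.formallyUnramified_algebraMap] at hr
      exact hr
    exact MorphismProperty.comp_mem @FormallyUnramified _ _ this inferInstance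

theorem isField_stalk_of_isGenericPoint {X : Scheme.{u}} [IsIntegral X] {η : X}
    (h : IsGenericPoint η Set.univ) : IsField (X.presheaf.stalk η) := by
  obtain rfl : η = genericPoint X := h.eq (genericPoint_spec X)
  exact Field.toIsField X.functionField

theorem Algebra.FormallyUnramified.of_isSeparable_of_isField {A B : Type u} [CommRing A] [CommRing B]
    [Algebra A B] (hA : IsField A) (hB : IsField B) [Algebra.IsSeparable A B] :
    Algebra.FormallyUnramified A B := by
  let := hA.toField
  let := hB.toField
  exact Algebra.FormallyUnramified.of_isSeparable A B

/-- At the generic point the stalk map is a separable extension of fields, hence unramified, and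
this spreads to an open neighbourhood. -/
theorem IsCurve.exists_formallyUnramified_comp {k : Type u} [Field k] {X Y : Scheme.{u}}
    {p : X ⟶ Spec (.of k)} {q : Y ⟶ Spec (.of k)} (hp : IsCurve p) (hq : IsCurve q) {f : X ⟶ Y}
    (hfq : f ≫ q = p) (hf : IsNonconstant f) (hsep : IsSeparableMorphism f) :
    ∃ (W : Scheme.{u}) (i : W ⟶ X), Nonempty W ∧ IsOpenImmersion i ∧
      FormallyUnramified (i ≫ f) := by
  have := hp.isIntegral
  have := hq.isIntegral
  have := hp.proper
  have : LocallyOfFiniteType (f ≫ q) := hfq ▸ inferInstance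
  have : LocallyOfFiniteType f := locallyOfFiniteType_of_comp f q
  have hgen := hq.map_genericPoint hf
  have hs := hsep (genericPoint X) (genericPoint_spec X)
  obtain ⟨W, i, hi, ⟨y, -⟩, h⟩ := exists_formallyUnramified_comp_of_stalkMap f (genericPoint X) (by
    let := (f.stalkMap (genericPoint X)).hom.toAlgebra
    exact Algebra.FormallyUnramified.of_isSeparable_of_isField
      (isField_stalk_of_isGenericPoint hgen)
      (isField_stalk_of_isGenericPoint (genericPoint_spec X)))
  exact ⟨W, i, ⟨y⟩, hi, h⟩

end Unramified
end

noncomputable section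

/-! ### Algebraic relation between the coordinates of two images -/

section Relation

open Polynomial

variable {k : Type u} [Field k] {X Y : Scheme.{u}} {p : X ⟶ Spec (.of k)} {q : Y ⟶ Spec (.of k)}

namespace EtaleChart

theorem exists_algHom_comp_eq (c : EtaleChart p) (c₀ : EtaleChart q) {f : X ⟶ Y} (hf : f ≫ q = p)
    (hr : Set.range (c.j ≫ f) ⊆ Set.range c₀.j) :
    ∃ φ : c₀.B →ₐ[k] c.B, Spec.map (CommRingCat.ofHom φ.toRingHom) ≫ c₀.j = c.j ≫ f := by
  obtain ⟨φ, hφ⟩ := Spec.map_surjective (IsOpenImmersion.lift c₀.j (c.j ≫ f) hr)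
  have hfac : Spec.map φ ≫ c₀.j = c.j ≫ f := by rw [hφ]; exact IsOpenImmersion.lift_fac _ _ _
  have hk : φ.hom.comp (c₀.g.comp C) = c.g.comp C := by
    have : Spec.map φ ≫ c₀.j ≫ q = Spec.map (CommRingCat.ofHom (c.g.comp C)) := by
      rw [← Category.assoc, hfac, Category.assoc, hf, c.comp]
    rw [c₀.comp, ← Spec.map_comp] at this
    exact congrArg CommRingCat.Hom.hom (Spec.map_injective this)
  exact ⟨⟨φ.hom, fun r => congr($hk r)⟩, hfac⟩

/-- The kernel is the image of the zero ideal under the map of spectra, and f preserves generic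
points. -/
theorem algHom_injective [IrreducibleSpace X] [IrreducibleSpace Y] {c : EtaleChart p}
    {c₀ : EtaleChart q} [IsDomain c.B] [IsDomain c₀.B] {f : X ⟶ Y}
    (hf : IsGenericPoint (f (genericPoint X)) Set.univ) {φ : c₀.B →ₐ[k] c.B}
    (hφ : Spec.map (CommRingCat.ofHom φ.toRingHom) ≫ c₀.j = c.j ≫ f) :
    Function.Injective φ := by
  have hcomp : ∀ y : Spec c.B,
      c₀.j (Spec.map (CommRingCat.ofHom φ.toRingHom) y) = f (c.j y) := fun y => by
    rw [← Scheme.Hom.comp_apply, hφ, Scheme.Hom.comp_apply]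
  have h : c₀.j (Spec.map (CommRingCat.ofHom φ.toRingHom) (⊥ : PrimeSpectrum c.B)) =
      c₀.j (⊥ : PrimeSpectrum c₀.B) := by
    refine (hcomp _).trans ?_
    rw [c.j_bot, c₀.j_bot]
    exact hf.eq (genericPoint_spec Y)
  have h' := congrArg PrimeSpectrum.asIdeal (c₀.j.isOpenEmbedding.injective h)
  exact (RingHom.injective_iff_ker_eq_bot φ.toRingHom).2 h'

variable {K : Type u} [Field K] [Algebra k K]

theorem map_toKPoint {c : EtaleChart p} {c₀ : EtaleChart q} {f : X ⟶ Y} (hf : f ≫ q = p)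
    {φ : c₀.B →ₐ[k] c.B} (hφ : Spec.map (CommRingCat.ofHom φ.toRingHom) ≫ c₀.j = c.j ≫ f)
    (h : c.B →ₐ[k] K) : KPoint.map K f hf (c.toKPoint h) = c₀.toKPoint (h.comp φ) := by
  refine Subtype.ext ?_
  change (Spec.map (CommRingCat.ofHom h.toRingHom) ≫ c.j) ≫ f = _
  rw [Category.assoc, ← hφ, ← Category.assoc, ← Spec.map_comp]
  rfl

/-- The `K`-point `y` lies in the étale chart `c`, and has coordinate `a` there. -/
def HasCoord (c : EtaleChart p) (y : KPoint K p) (a : K) : Prop :=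
  ∃ h : c.B →ₐ[k] K, c.toKPoint h = y ∧ h c.coord = a

theorem HasCoord.unique {c : EtaleChart p} {y : KPoint K p} {a b : K} (ha : c.HasCoord y a)
    (hb : c.HasCoord y b) : a = b := by
  obtain ⟨h, rfl, rfl⟩ := ha
  obtain ⟨h', hh, rfl⟩ := hb
  rw [c.toKPoint_injective hh]

theorem transcendental_coord (c : EtaleChart p) [IsDomain c.B] : Transcendental k c.coord := by
  rw [transcendental_iff_injective]
  have : ⇑(aeval (R := k) c.coord) = algebraMap k[X] c.B := by
    have h : aeval (R := k) c.coord = IsScalarTower.toAlgHom k k[X] c.B :=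
      Polynomial.algHom_ext (by simp [coord])
    rw [h]; rfl
  rw [this]
  exact FaithfulSMul.algebraMap_injective _ _

end EtaleChart

/-- On a chart mapped into `c₀` by both morphisms, the pullback of the coordinate along f₁ remains
transcendental, so `EtalePolynomial.exists_relation` applies to the two pullbacks; the exceptions
lie outside a non-empty open set. -/
theorem IsCurve.exists_finite_setOf_not_polyRelated (hp : IsCurve p) (hq : IsCurve q)
    (c₀ : EtaleChart q) [Nonempty (Spec c₀.B)] (K : Type u) [Field K] [Algebra k K]
    {f₁ f₂ : X ⟶ Y} (h₁ : f₁ ≫ q = p) (h₂ : f₂ ≫ q = p) (hf₁ : IsNonconstant f₁)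
    (hf₂ : IsNonconstant f₂) :
    ∃ F : K[X][X], {x : KPoint K p | ¬ DirectedGraph.PolyRelated c₀.HasCoord {F}
      (KPoint.map K f₁ h₁ x) (KPoint.map K f₂ h₂ x)}.Finite := by
  have := hp.irreducibleSpace
  have := hq.irreducibleSpace
  have := hp.smooth
  have := c₀.isDomain
  have hg₁ := hq.map_genericPoint hf₁
  have hg₂ := hq.map_genericPoint hf₂
  have hmem : ∀ {f : X ⟶ Y}, IsGenericPoint (f (genericPoint X)) Set.univ →
      genericPoint X ∈ f ⁻¹ᵁ c₀.j.opensRange := fun {f} hf =>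
    ⟨(⊥ : PrimeSpectrum c₀.B), by rw [c₀.j_bot]; exact (genericPoint_spec Y).eq hf⟩
  obtain ⟨c, ⟨y, hy⟩, hcW⟩ := EtaleChart.exists_range_subset p
    (W := f₁ ⁻¹ᵁ c₀.j.opensRange ⊓ f₂ ⁻¹ᵁ c₀.j.opensRange) ⟨hmem hg₁, hmem hg₂⟩
  have : Nonempty (Spec c.B) := ⟨y⟩
  have := c.isDomain
  obtain ⟨φ₁, hφ₁⟩ := c.exists_algHom_comp_eq c₀ h₁ (by
    rintro _ ⟨y, rfl⟩
    exact (hcW ⟨y, rfl⟩).1)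
  obtain ⟨φ₂, hφ₂⟩ := c.exists_algHom_comp_eq c₀ h₂ (by
    rintro _ ⟨y, rfl⟩
    exact (hcW ⟨y, rfl⟩).2)
  have ht : Transcendental k (φ₁ c₀.coord) :=
    fun h => c₀.transcendental_coord
      ((isAlgebraic_algHom_iff φ₁ (EtaleChart.algHom_injective hg₁ hφ₁)).1 h)
  obtain ⟨F, b, hb0, hF⟩ := EtalePolynomial.exists_relation k c.B ht (φ₂ c₀.coord)
  refine ⟨F.map (mapRingHom (algebraMap k K)), ?_⟩
  let V : X.Opens := c.j ''ᵁ PrimeSpectrum.basicOpen b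
  have hV : (V : Set X).Nonempty := ⟨_, (⊥ : PrimeSpectrum c.B), fun h => hb0 (Ideal.mem_bot.1 h), rfl⟩
  refine (hp.finite_setOf_pt_notMem K hV).subset fun x hx hxV => hx ?_
  obtain ⟨P, hP, hPx⟩ := hxV
  obtain ⟨h, rfl⟩ := c.exists_toKPoint_eq ⟨P, hPx⟩
  rw [c.pt_toKPoint] at hPx
  obtain rfl := c.j.isOpenEmbedding.injective hPx
  have hhb : h b ≠ 0 := hP
  obtain ⟨hne, heval⟩ := hF K h hhb
  exact ⟨_, rfl, _, _, ⟨_, (EtaleChart.map_toKPoint h₁ hφ₁ h).symm, rfl⟩,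
    ⟨_, (EtaleChart.map_toKPoint h₂ hφ₂ h).symm, rfl⟩, hne, heval⟩

end Relation

/-! ### Ramification indices after base change -/

section Ramification

theorem ramificationIndexAt_eq_one {X Y : Scheme.{u}} (f : X ⟶ Y) [LocallyOfFiniteType f] (x : X)
    (H : (f.stalkMap x).hom.FormallyUnramified) : ramificationIndexAt f x = 1 := by
  unfold ramificationIndexAt
  let := (f.stalkMap x).hom.toAlgebra
  have : Algebra.EssFiniteType (Y.presheaf.stalk (f x)) (X.presheaf.stalk x) :=
    LocallyOfFiniteType.stalkMap f x
  have : Algebra.FormallyUnramified (Y.presheaf.stalk (f x)) (X.presheaf.stalk x) := H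
  -- The criterion for index 1 concerns the localization at m, so unramifiedness is first carried
  -- from the local ring to its localization at its own maximal ideal.
  let m := IsLocalRing.maximalIdeal (X.presheaf.stalk x)
  have : Algebra.FormallyUnramified (X.presheaf.stalk x) (Localization.AtPrime m) :=
    .of_isLocalization m.primeCompl
  have : Algebra.IsUnramifiedAt (Y.presheaf.stalk (f x)) m :=
    Algebra.FormallyUnramified.comp _ (X.presheaf.stalk x) _
  exact Ideal.ramificationIdx_eq_one m (Y.presheaf.stalk (f x))

theorem formallyUnramified_stalkMap_of_comp {W X Y : Scheme.{u}} (i : W ⟶ X) [IsOpenImmersion i]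
    (f : X ⟶ Y) [FormallyUnramified (i ≫ f)] (y : W) :
    (f.stalkMap (i y)).hom.FormallyUnramified := by
  have h := FormallyUnramified.stalkMap (i ≫ f) y
  rw [Scheme.Hom.stalkMap_comp] at h
  exact (RingHom.FormallyUnramified.respectsIso.cancel_right_isIso _ (i.stalkMap y)).1 h

variable {k : Type u} [Field k] (K : Type u) [Field K] [Algebra k K] {W X Y : Scheme.{u}}
  {p : X ⟶ Spec (.of k)} {q : Y ⟶ Spec (.of k)} {r : W ⟶ Spec (.of k)}

theorem baseChangeMap_fst (f : X ⟶ Y) (hf : f ≫ q = p) :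
    baseChangeMap K f hf ≫ pullback.fst q (baseMap K) = pullback.fst p (baseMap K) ≫ f :=
  pullback.lift_fst _ _ _

theorem baseChangeMap_snd (f : X ⟶ Y) (hf : f ≫ q = p) :
    baseChangeMap K f hf ≫ pullback.snd q (baseMap K) = pullback.snd p (baseMap K) :=
  (pullback.lift_snd _ _ _).trans (Category.comp_id _)

theorem isPullback_baseChangeMap (f : X ⟶ Y) (hf : f ≫ q = p) :
    IsPullback (baseChangeMap K f hf) (pullback.fst p (baseMap K)) (pullback.fst q (baseMap K))
      f := by
  have h1 := (IsPullback.of_hasPullback q (baseMap (k := k) K)).flip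
  have h2 := (IsPullback.of_hasPullback p (baseMap (k := k) K)).flip
  refine IsPullback.of_right ?_ (baseChangeMap_fst K f hf) h1
  rw [baseChangeMap_snd, hf]
  exact h2

theorem baseChangeMap_comp (i : W ⟶ X) (f : X ⟶ Y) (hi : i ≫ p = r) (hf : f ≫ q = p) :
    baseChangeMap K i hi ≫ baseChangeMap K f hf =
      baseChangeMap K (i ≫ f) (by rw [Category.assoc, hf, hi]) := by
  apply pullback.hom_ext
  · rw [Category.assoc, baseChangeMap_fst, ← Category.assoc, baseChangeMap_fst, baseChangeMap_fst,
      Category.assoc]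
  · rw [Category.assoc, baseChangeMap_snd, baseChangeMap_snd, baseChangeMap_snd]

variable {K}

theorem KPoint.toBaseChange_map (i : W ⟶ X) (hi : i ≫ p = r) (x : KPoint K r) :
    (KPoint.map K i hi x).toBaseChange = baseChangeMap K i hi x.toBaseChange := by
  have h : pullback.lift (x.1 ≫ i) (𝟙 (Spec (.of K))) (by simp [hi, x.2]) =
      pullback.lift x.1 (𝟙 (Spec (.of K))) (by simp [x.2]) ≫ baseChangeMap K i hi := by
    apply pullback.hom_ext
    · refine (pullback.lift_fst _ _ _).trans ?_
      rw [Category.assoc, baseChangeMap_fst, pullback.lift_fst_assoc]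
    · refine (pullback.lift_snd _ _ _).trans ?_
      rw [Category.assoc, baseChangeMap_snd, pullback.lift_snd]
  have h' : ∀ y : Spec (.of K), pullback.lift (x.1 ≫ i) (𝟙 (Spec (.of K))) (by simp [hi, x.2]) y =
      baseChangeMap K i hi (pullback.lift x.1 (𝟙 (Spec (.of K))) (by simp [x.2]) y) := fun y => by
    rw [h, Scheme.Hom.comp_apply]
  exact h' _

theorem KPoint.exists_map_eq (i : W ⟶ X) [IsOpenImmersion i] (hi : i ≫ p = r) {x : KPoint K p}
    (hx : x.pt ∈ Set.range i) : ∃ y : KPoint K r, KPoint.map K i hi y = x := by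
  have hfac := IsOpenImmersion.lift_fac i x.1 (EtaleChart.range_subset_of_pt_mem hx)
  exact ⟨⟨IsOpenImmersion.lift i x.1 (EtaleChart.range_subset_of_pt_mem hx), by
    rw [← hi, ← Category.assoc, hfac, x.2]⟩, Subtype.ext hfac⟩

theorem KPoint.pt_map (i : W ⟶ X) (hi : i ≫ p = r) (x : KPoint K r) :
    (KPoint.map K i hi x).pt = i x.pt := rfl

theorem ramificationIndexAt_baseChangeMap_eq_one (i : W ⟶ X) [IsOpenImmersion i] (f : X ⟶ Y)
    (hf : f ≫ q = p) [LocallyOfFiniteType f] [FormallyUnramified (i ≫ f)] {x : KPoint K p}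
    (hx : x.pt ∈ Set.range i) :
    ramificationIndexAt (baseChangeMap K f hf) x.toBaseChange = 1 := by
  obtain ⟨y, rfl⟩ := KPoint.exists_map_eq i rfl hx
  have : LocallyOfFiniteType (baseChangeMap K f hf) :=
    MorphismProperty.of_isPullback (isPullback_baseChangeMap K f hf).flip ‹_›
  have : IsOpenImmersion (baseChangeMap K i (rfl : i ≫ p = _)) :=
    MorphismProperty.of_isPullback (isPullback_baseChangeMap K i _).flip ‹_›
  have : FormallyUnramified (baseChangeMap K i (rfl : i ≫ p = _) ≫ baseChangeMap K f hf) := by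
    rw [baseChangeMap_comp]
    exact MorphismProperty.of_isPullback (isPullback_baseChangeMap K (i ≫ f) _).flip ‹_›
  rw [KPoint.toBaseChange_map]
  exact ramificationIndexAt_eq_one _ _ (formallyUnramified_stalkMap_of_comp _ _ _)

end Ramification
end

/-! ### Assembly over the components of the correspondence -/

namespace SelfCorrespondence

variable {k : Type u} [Field k] {C : Scheme.{u}} {p : C ⟶ Spec (.of k)}
  (𝒟 : SelfCorrespondence p) (K : Type u) [Field K] [Algebra k K]

theorem compactSpace : CompactSpace 𝒟.D := by
  have := 𝒟.proper
  exact QuasiCompact.compactSpace_of_compactSpace 𝒟.str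

theorem exists_component (x : 𝒟.D) : ∃ U : 𝒟.D.Opens, x ∈ U ∧ IsCurve (U.ι ≫ 𝒟.str) ∧
    IsNonconstant (U.ι ≫ 𝒟.π₁) ∧ IsSeparableMorphism (U.ι ≫ 𝒟.π₁) ∧
    IsNonconstant (U.ι ≫ 𝒟.π₂) ∧ IsSeparableMorphism (U.ι ≫ 𝒟.π₂) := by
  obtain ⟨U, hU, h⟩ := 𝒟.component x
  refine ⟨U, ?_, h⟩
  change x ∈ (U : Set 𝒟.D)
  rw [hU]
  exact mem_connectedComponent

variable {K} in
theorem inter_preimage_subset (U : 𝒟.D.Opens) (P : KPoint K 𝒟.str → Prop) :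
    {z | P z} ∩ KPoint.pt ⁻¹' (U : Set 𝒟.D) ⊆
      KPoint.map K U.ι rfl '' {x | P (KPoint.map K U.ι rfl x)} := by
  rintro z ⟨hz, hzU⟩
  obtain ⟨x, rfl⟩ := KPoint.exists_map_eq U.ι rfl (x := z) (by rw [Scheme.Opens.range_ι]; exact hzU)
  exact ⟨x, hz, rfl⟩

theorem finite_setOf_ramificationIndexAt_ne_one (hC : IsCurve p) {f : 𝒟.D ⟶ C}
    (hf : f ≫ p = 𝒟.str)
    (h : ∀ x : 𝒟.D, ∃ U : 𝒟.D.Opens, x ∈ U ∧ IsCurve (U.ι ≫ 𝒟.str) ∧ IsNonconstant (U.ι ≫ f) ∧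
      IsSeparableMorphism (U.ι ≫ f)) :
    {z : KPoint K 𝒟.str | ramificationIndexAt (baseChangeMap K f hf) z.toBaseChange ≠ 1}.Finite := by
  have := 𝒟.compactSpace
  have := 𝒟.proper
  have : LocallyOfFiniteType (f ≫ p) := hf ▸ inferInstance
  have : LocallyOfFiniteType f := locallyOfFiniteType_of_comp f p
  refine finite_of_forall_exists_mem_nhds KPoint.pt fun x => ?_
  obtain ⟨U, hxU, hU, hnc, hsep⟩ := h x
  refine ⟨U, U.2.mem_nhds hxU, ?_⟩
  obtain ⟨W, i, ⟨w⟩, hi, hunr⟩ :=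
    hU.exists_formallyUnramified_comp hC (by rw [Category.assoc, hf]) hnc hsep
  refine Set.Finite.subset (Set.Finite.image _ ?_) (𝒟.inter_preimage_subset U _)
  refine (hU.finite_setOf_pt_notMem K (V := i.opensRange) ⟨i w, w, rfl⟩).subset ?_
  rintro y hy ⟨v, hv⟩
  have : FormallyUnramified ((i ≫ U.ι) ≫ f) := by rwa [Category.assoc]
  refine hy (ramificationIndexAt_baseChangeMap_eq_one (i ≫ U.ι) f hf ⟨v, ?_⟩)
  rw [KPoint.pt_map, Scheme.Hom.comp_apply, hv]

theorem finite_setOf_not_isEtaleEdge (hC : IsCurve p) :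
    {z : (𝒟.graph K).Z | ¬ 𝒟.IsEtaleEdge K z}.Finite := by
  have h₁ := 𝒟.finite_setOf_ramificationIndexAt_ne_one K hC 𝒟.comp_π₁ fun x => by
    obtain ⟨U, hx, hU, h₁, h₂, -⟩ := 𝒟.exists_component x
    exact ⟨U, hx, hU, h₁, h₂⟩
  have h₂ := 𝒟.finite_setOf_ramificationIndexAt_ne_one K hC 𝒟.comp_π₂ fun x => by
    obtain ⟨U, hx, hU, -, -, h₁, h₂⟩ := 𝒟.exists_component x
    exact ⟨U, hx, hU, h₁, h₂⟩
  refine (h₁.union h₂).subset fun z hz => ?_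
  by_contra hcon
  rw [Set.mem_union, not_or] at hcon
  exact hz ⟨not_not.1 hcon.1, not_not.1 hcon.2⟩

open Polynomial in
theorem exists_finite_setOf_not_polyRelated (hC : IsCurve p) (c₀ : EtaleChart p)
    [Nonempty (Spec c₀.B)] {f₁ f₂ : 𝒟.D ⟶ C} (hf₁ : f₁ ≫ p = 𝒟.str) (hf₂ : f₂ ≫ p = 𝒟.str)
    (h : ∀ x : 𝒟.D, ∃ U : 𝒟.D.Opens, x ∈ U ∧ IsCurve (U.ι ≫ 𝒟.str) ∧ IsNonconstant (U.ι ≫ f₁) ∧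
      IsNonconstant (U.ι ≫ f₂)) :
    ∃ E : Set K[X][X], E.Finite ∧ {z : KPoint K 𝒟.str | ¬ DirectedGraph.PolyRelated c₀.HasCoord E
      (KPoint.map K f₁ hf₁ z) (KPoint.map K f₂ hf₂ z)}.Finite := by
  have := 𝒟.compactSpace
  -- Each component supplies one relation; compactness of D keeps the total number finite.
  have key := isCompact_univ.induction_on (X := 𝒟.D) (p := fun U => ∃ E : Set K[X][X], E.Finite ∧
    ({z : KPoint K 𝒟.str | ¬ DirectedGraph.PolyRelated c₀.HasCoord E
      (KPoint.map K f₁ hf₁ z) (KPoint.map K f₂ hf₂ z)} ∩ KPoint.pt ⁻¹' U).Finite)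
    ⟨∅, Set.finite_empty, by simp⟩ ?_ ?_ ?_
  · obtain ⟨E, hE, hfin⟩ := key
    exact ⟨E, hE, by simpa using hfin⟩
  · rintro s t hst ⟨E, hE, ht⟩
    exact ⟨E, hE, ht.subset (Set.inter_subset_inter_right _ (Set.preimage_mono hst))⟩
  · rintro s t ⟨E, hE, hs⟩ ⟨E', hE', ht⟩
    refine ⟨E ∪ E', hE.union hE', (hs.union ht).subset ?_⟩
    rintro z ⟨hz, hzs | hzt⟩
    · exact Or.inl ⟨fun hz' => hz (hz'.mono Set.subset_union_left), hzs⟩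
    · exact Or.inr ⟨fun hz' => hz (hz'.mono Set.subset_union_right), hzt⟩
  · intro x _
    obtain ⟨U, hxU, hU, h₁, h₂⟩ := h x
    obtain ⟨F, hF⟩ := hU.exists_finite_setOf_not_polyRelated hC c₀ K (f₁ := U.ι ≫ f₁)
      (f₂ := U.ι ≫ f₂) (by rw [Category.assoc, hf₁]) (by rw [Category.assoc, hf₂]) h₁ h₂
    refine ⟨U, mem_nhdsWithin_of_mem_nhds (U.2.mem_nhds hxU), {F}, Set.finite_singleton F, ?_⟩
    exact Set.Finite.subset (hF.image _) (𝒟.inter_preimage_subset U _)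

theorem infinite_setOf_isIrreducibleComplete (hC : IsCurve p) [IsAlgClosed K] :
    {S : Set (𝒟.graph K).V | (𝒟.graph K).IsIrreducibleComplete S}.Infinite := by
  have := hC.irreducibleSpace
  have := hC.smooth
  obtain ⟨c₀, ⟨y, -⟩⟩ := EtaleChart.exists_mem_range p (genericPoint C)
  have : Nonempty (Spec c₀.B) := ⟨y⟩
  have := c₀.isDomain
  obtain ⟨E, hE, hst⟩ := 𝒟.exists_finite_setOf_not_polyRelated K hC c₀ 𝒟.comp_π₁ 𝒟.comp_π₂
    fun x => by
      obtain ⟨U, hx, hU, h₁, -, h₂, -⟩ := 𝒟.exists_component x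
      exact ⟨U, hx, hU, h₁, h₂⟩
  obtain ⟨E', hE', hts⟩ := 𝒟.exists_finite_setOf_not_polyRelated K hC c₀ 𝒟.comp_π₂ 𝒟.comp_π₁
    fun x => by
      obtain ⟨U, hx, hU, h₁, -, h₂, -⟩ := 𝒟.exists_component x
      exact ⟨U, hx, hU, h₂, h₁⟩
  refine DirectedGraph.infinite_setOf_isIrreducibleComplete (Γ := 𝒟.graph K) (R := c₀.HasCoord)
    (fun x a b => EtaleChart.HasCoord.unique)
    ((EtalePolynomial.finite_setOf_forall_ne k c₀.B K).subset fun a ha h hh =>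
      ha (c₀.toKPoint h) ⟨h, rfl, hh⟩)
    (hE.union hE') (hst.subset fun z hz hz' => hz (hz'.mono Set.subset_union_left))
    (hts.subset fun z hz hz' => hz (hz'.mono Set.subset_union_right))

theorem finite_setOf_isIrreducibleComplete_not_isEtaleSet (hC : IsCurve p) :
    {S : Set (𝒟.graph K).V | (𝒟.graph K).IsIrreducibleComplete S ∧
      ¬ 𝒟.IsEtaleSet K S}.Finite := by
  refine (DirectedGraph.finite_setOf_isIrreducibleComplete_inter
    ((𝒟.finite_setOf_not_isEtaleEdge K hC).image (𝒟.graph K).s)).subset ?_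
  rintro S ⟨hS, hne⟩
  simp only [IsEtaleSet, not_forall] at hne
  obtain ⟨z, hz, -, hze⟩ := hne
  exact ⟨hS, _, hz, z, hze, rfl⟩

end SelfCorrespondence

theorem mainTheorem11 {k : Type u} [Field k] (kbar : Type u) [Field kbar] [Algebra k kbar]
    [IsAlgClosure k kbar] {C : Scheme.{u}} (p : C ⟶ Spec (.of k)) (hC : IsCurve p)
    (𝒟 : SelfCorrespondence p) :
    {S : Set (𝒟.graph kbar).V | (𝒟.graph kbar).IsIrreducibleComplete S}.Infinite ∧
    {S : Set (𝒟.graph kbar).V | (𝒟.graph kbar).IsIrreducibleComplete S ∧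
      ¬ 𝒟.IsEtaleSet kbar S}.Finite := by
  have : IsAlgClosed kbar := IsAlgClosure.isAlgClosed k
  exact ⟨𝒟.infinite_setOf_isIrreducibleComplete kbar hC,
    𝒟.finite_setOf_isIrreducibleComplete_not_isEtaleSet kbar hC⟩
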